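/- Let $d\ge 1$ and $N\ge 1$. A signed permutation matrix is a real square matrix in which every row and every column has exactly one non-zero entry, and this entry is $1$ or $-1$. A family $L_1,\dots,L_N$ of $d\times d$ signed permutation matrices is said to satisfy $\mathcal{GR}(d,N)$ if, for all $I,J\in\{1,\dots,N\}$, \[ L_IL_J^{T}+L_JL_I^{T}=2\delta_{IJ}\,\mathbb I,\qquad L_I^{T}L_J+L_J^{T}L_I=2\delta_{IJ}\,\mathbb I . \] Write $|L|$ for the matrix of entrywise absolute values of $L$, and identify a permutation $\sigma\in S_d$ with the permutation matrix sending the standard basis vector $e_j$ to $e_{\sigma(j)}$. Label the points of the cube $(\mathbb Z/2)^3$ by $1,\dots,8$, the labels $1,2,3,4,5,6,7,8$ being given to $(0,0,0)$, $(1,0,0)$, $(0,1,0)$, $(1,1,0)$, $(0,0,1)$, $(1,0,1)$, $(0,1,1)$, $(1,1,1)$ respectively, and let $A\le S_8$ be the group of those permutations of the labels that are given by the translations $x\mapsto x+t$, $t\in(\mathbb Z/2)^3$. **Theorem.** If $L_1,\dots,L_8$ satisfy $\mathcal{GR}(8,8)$, then there are a permutation $\pi\in S_8$ and a subgroup $B\le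 S_8$ conjugate to $A$ in $S_8$ such that \[ \{|L_1|,\dots,|L_8|\}=\pi B . \] Moreover, $A$ consists of the eight permutations \[ \begin{gathered} (\,),\quad (1\,2)(3\,4)(5\,6)(7\,8),\quad (1\,3)(2\,4)(5\,7)(6\,8),\quad (1\,5)(2\,6)(3\,7)(4\,8),\\ (1\,8)(2\,7)(3\,6)(4\,5),\quad (1\,7)(2\,8)(3\,5)(4\,6),\quad (1\,6)(2\,5)(3\,8)(4\,7),\quad (1\,4)(2\,3)(5\,8)(6\,7), \end{gathered} \] it is isomorphic to $(\mathbb Z/2)^3$, and it is not a normal subgroup of $S_8$. -/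

import Mathlib

open scoped Pointwise

/-- A signed permutation matrix: each row and each column has exactly one non-zero entry,
and every non-zero entry is `1` or `-1`. -/
structure IsSignedPermMatrix {d : ℕ} (M : Matrix (Fin d) (Fin d) ℝ) : Prop where
  row : ∀ i, ∃! j, M i j ≠ 0
  col : ∀ j, ∃! i, M i j ≠ 0
  entry : ∀ i j, M i j ≠ 0 → M i j = 1 ∨ M i j = -1

/-- The family `L₁, …, L_N` of `d × d` signed permutation matrices satisfies the
`GR(d, N)` ("garden algebra") relations. -/
structure IsGR (d N : ℕ) (L : Fin N → Matrix (Fin d) (Fin d) ℝ) : Prop where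
  pos : 0 < N
  signedPerm : ∀ I, IsSignedPermMatrix (L I)
  mul_transpose : ∀ I J, L I * (L J).transpose + L J * (L I).transpose
    = (2 * (if I = J then 1 else 0) : ℝ) • (1 : Matrix (Fin d) (Fin d) ℝ)
  transpose_mul : ∀ I J, (L I).transpose * L J + (L J).transpose * L I
    = (2 * (if I = J then 1 else 0) : ℝ) • (1 : Matrix (Fin d) (Fin d) ℝ)

/-- `|M|`: the matrix of entrywise absolute values. -/
def entrywiseAbs {d : ℕ} (M : Matrix (Fin d) (Fin d) ℝ) : Matrix (Fin d) (Fin d) ℝ :=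
  M.map (fun x => |x|)

/-- The matrix of the permutation `σ`, acting on the standard basis by `e_j ↦ e_{σ j}`. -/
def permToMatrix {d : ℕ} (σ : Equiv.Perm (Fin d)) : Matrix (Fin d) (Fin d) ℝ :=
  Matrix.of fun i j => if i = σ j then 1 else 0

/-- The vertices of the cube, as points of `(ℤ/2)³`; the labels `1, …, 8` are
written `0, …, 7`. -/
def cubeVertex : Fin 8 → (Fin 3 → ZMod 2) :=
  ![![0, 0, 0], ![1, 0, 0], ![0, 1, 0], ![1, 1, 0],
    ![0, 0, 1], ![1, 0, 1], ![0, 1, 1], ![1, 1, 1]]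

/-- The group `A ≤ S₈` of translations modulo 2 of the labelled cube. -/
def cubeTranslations : Subgroup (Equiv.Perm (Fin 8)) where
  carrier := {p | ∃ t : Fin 3 → ZMod 2, ∀ i, cubeVertex (p i) = cubeVertex i + t}
  one_mem' := ⟨0, fun i => by simp⟩
  mul_mem' := by
    rintro p q ⟨s, hs⟩ ⟨t, ht⟩
    exact ⟨t + s, fun i => by rw [Equiv.Perm.mul_apply, hs, ht, add_assoc]⟩
  inv_mem' := by
    rintro p ⟨t, ht⟩
    refine ⟨-t, fun i => ?_⟩
    have h := ht (p⁻¹ i)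
    rw [show p (p⁻¹ i) = i from Equiv.apply_symm_apply p i] at h
    rw [h, add_neg_cancel_right]

/-- The eight permutations `a₁, …, a₈` in disjoint cycle notation (labels shifted down by
one): `()`, `(12)(34)(56)(78)`, `(13)(24)(57)(68)`, `(15)(26)(37)(48)`,
`(18)(27)(36)(45)`, `(17)(28)(35)(46)`, `(16)(25)(38)(47)`, `(14)(23)(58)(67)`. -/
def aPerm : Fin 8 → Equiv.Perm (Fin 8) :=
  ![1,
    Equiv.swap 0 1 * Equiv.swap 2 3 * Equiv.swap 4 5 * Equiv.swap 6 7,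
    Equiv.swap 0 2 * Equiv.swap 1 3 * Equiv.swap 4 6 * Equiv.swap 5 7,
    Equiv.swap 0 4 * Equiv.swap 1 5 * Equiv.swap 2 6 * Equiv.swap 3 7,
    Equiv.swap 0 7 * Equiv.swap 1 6 * Equiv.swap 2 5 * Equiv.swap 3 4,
    Equiv.swap 0 6 * Equiv.swap 1 7 * Equiv.swap 2 4 * Equiv.swap 3 5,
    Equiv.swap 0 5 * Equiv.swap 1 4 * Equiv.swap 2 7 * Equiv.swap 3 6,
    Equiv.swap 0 3 * Equiv.swap 1 2 * Equiv.swap 4 7 * Equiv.swap 5 6]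

/-- `B` is a conjugate `g H g⁻¹` of the subgroup `H`. -/
def IsConjSubgroup {G : Type*} [Group G] (H B : Subgroup G) : Prop :=
  ∃ g : G, B = H.map (MulAut.conj g).toMonoidHom

/-! Let `σ I` be the permutation supporting `L I`. For `I ≠ J`, antisymmetry of `(L I)ᵀ * L J` makes
`(σ I)⁻¹ * σ J` an involution (`mul_inv_mul_of_anticommute`) without fixed points
(`apply_ne_of_anticommute`). Hence the `(σ 0)⁻¹ * σ I` are commuting involutions with distinct
values at every point; being eight on eight points, they are transitive and form a regular
elementary abelian group. The orbit map of a point conjugates such a group to the translations of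
`𝔽₂³`. -/

namespace IsSignedPermMatrix

/-- The support of a signed permutation matrix is the graph of a permutation. -/
theorem exists_perm {d : ℕ} {M : Matrix (Fin d) (Fin d) ℝ} (hM : IsSignedPermMatrix M) :
    ∃ σ : Equiv.Perm (Fin d), ∀ i j, M i j ≠ 0 ↔ i = σ j := by
  choose f hf hf' using hM.col
  have hinj : Function.Injective f := by
    intro a b hab
    exact (hM.row (f a)).unique (hf a) (by rw [hab]; exact hf b)
  refine ⟨Equiv.ofBijective f (Finite.injective_iff_bijective.mp hinj), fun i j => ?_⟩
  rw [Equiv.ofBijective_apply]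
  exact ⟨hf' j i, fun h => h ▸ hf j⟩

end IsSignedPermMatrix

theorem entrywiseAbs_eq_permToMatrix {d : ℕ} {M : Matrix (Fin d) (Fin d) ℝ}
    (hM : IsSignedPermMatrix M) {σ : Equiv.Perm (Fin d)} (hσ : ∀ i j, M i j ≠ 0 ↔ i = σ j) :
    entrywiseAbs M = permToMatrix σ := by
  ext i j
  simp only [entrywiseAbs, permToMatrix, Matrix.map_apply, Matrix.of_apply]
  split_ifs with h
  · rcases hM.entry i j ((hσ i j).mpr h) with h1 | h1 <;> simp [h1]
  · simpa using not_imp_comm.mp (hσ i j).mp h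

/-! ### Supports of anticommuting pairs -/

section Anticommuting

variable {d : ℕ} {M N : Matrix (Fin d) (Fin d) ℝ} {σ τ : Equiv.Perm (Fin d)}

theorem transpose_mul_apply_of_support (hσ : ∀ i j, M i j ≠ 0 ↔ i = σ j) (j k : Fin d) :
    (M.transpose * N) j k = M (σ j) j * N (σ j) k := by
  rw [Matrix.mul_apply]
  refine Finset.sum_eq_single (σ j) (fun i _ hi => ?_) (by simp)
  rw [Matrix.transpose_apply, not_imp_comm.mp (hσ i j).mp hi, zero_mul]

theorem transpose_mul_add_apply_of_support (hσ : ∀ i j, M i j ≠ 0 ↔ i = σ j)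
    (hτ : ∀ i j, N i j ≠ 0 ↔ i = τ j)
    (h : M.transpose * N + N.transpose * M = 0) (j k : Fin d) :
    M (σ j) j * N (σ j) k + N (τ j) j * M (τ j) k = 0 := by
  rw [← transpose_mul_apply_of_support hσ, ← transpose_mul_apply_of_support hτ,
    ← Matrix.add_apply, h, Matrix.zero_apply]

/-- At a common value the two terms of the diagonal entry coincide and cannot cancel. -/
theorem apply_ne_of_anticommute (hσ : ∀ i j, M i j ≠ 0 ↔ i = σ j)
    (hτ : ∀ i j, N i j ≠ 0 ↔ i = τ j)
    (h : M.transpose * N + N.transpose * M = 0) (j : Fin d) : σ j ≠ τ j := by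
  intro hj
  have h1 := transpose_mul_add_apply_of_support hσ hτ h j j
  have hM := (hσ (σ j) j).mpr rfl
  have hN := (hτ (σ j) j).mpr hj
  rw [← hj, mul_comm (N _ _), ← two_mul] at h1
  exact mul_ne_zero two_ne_zero (mul_ne_zero hM hN) h1

theorem mul_inv_mul_of_anticommute (hσ : ∀ i j, M i j ≠ 0 ↔ i = σ j)
    (hτ : ∀ i j, N i j ≠ 0 ↔ i = τ j)
    (h : M.transpose * N + N.transpose * M = 0) : σ * τ⁻¹ * σ = τ := by
  ext1 j
  -- In this column the first product is nonzero, so the second must be too.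
  have h1 := transpose_mul_add_apply_of_support hσ hτ h j (τ⁻¹ (σ j))
  have hM := (hσ (σ j) j).mpr rfl
  have hN : N (σ j) (τ⁻¹ (σ j)) ≠ 0 :=
    (hτ _ _).mpr (Equiv.apply_symm_apply τ (σ j)).symm
  refine ((hσ _ _).mp fun h0 => ?_).symm
  rw [h0, mul_zero, add_zero] at h1
  exact mul_ne_zero hM hN h1

end Anticommuting

/-! ### Translations of the cube -/

section Cube

theorem cubeVertex_injective : Function.Injective cubeVertex := by decide

theorem cubeVertex_bijective : Function.Bijective cubeVertex :=
  (Fintype.bijective_iff_injective_and_card _).mpr ⟨cubeVertex_injective, by simp⟩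

/-- The labelling of the vertices of the cube, as an equivalence. -/
noncomputable def cubeEquiv : Fin 8 ≃ (Fin 3 → ZMod 2) :=
  Equiv.ofBijective cubeVertex cubeVertex_bijective

/-- An elementary abelian `2`-subgroup of `S₈` acting regularly is conjugate to the group of
translations of the cube. -/
theorem isConjSubgroup_cubeTranslations_of_regular (T : Subgroup (Equiv.Perm (Fin 8)))
    (hsq : ∀ t ∈ T, t * t = 1)
    (hreg : Function.Bijective fun t : T => (t : Equiv.Perm (Fin 8)) 0) :
    IsConjSubgroup cubeTranslations T := by
  let _ : CommGroup T :=
    { (inferInstance : Group T) with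
      mul_comm := fun a b => by
        have hinv : ∀ t : T, t⁻¹ = t := fun t =>
          inv_eq_of_mul_eq_one_right (Subtype.ext (hsq t t.2))
        rw [← hinv (a * b), mul_inv_rev, hinv, hinv] }
  let _ : Module (ZMod 2) (Additive T) := AddCommGroup.zmodModule fun t => by
    rw [two_nsmul]
    exact Subtype.ext (hsq _ t.toMul.2)
  have hcard : Nat.card (Additive T) = 8 := by
    rw [Nat.card_congr Additive.toMul, Nat.card_congr (Equiv.ofBijective _ hreg), Nat.card_fin]
  have hrank : Module.finrank (ZMod 2) (Additive T) = 3 := by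
    have h := Module.natCard_eq_pow_finrank (K := ZMod 2) (V := Additive T)
    rw [hcard, Nat.card_zmod] at h
    exact (Nat.pow_right_injective le_rfl (h.symm.trans (by norm_num : 8 = 2 ^ 3)))
  let e : (Fin 3 → ZMod 2) ≃ₗ[ZMod 2] Additive T :=
    LinearEquiv.ofFinrankEq _ _ (by rw [hrank]; simp)
  let φ : (Fin 3 → ZMod 2) → Equiv.Perm (Fin 8) := fun v => ((e v).toMul : T)
  have hφ : ∀ u v, φ (u + v) = φ v * φ u := by
    intro u v
    simp only [φ, add_comm u v, map_add, toMul_add, Subgroup.coe_mul]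
  -- The orbit map of `0`, which intertwines translation by `t` with `φ t`.
  let g : Equiv.Perm (Fin 8) :=
    ((cubeEquiv.trans e.toEquiv).trans Additive.toMul).trans (Equiv.ofBijective _ hreg)
  have hg : ∀ i, g i = φ (cubeVertex i) 0 := fun i => rfl
  refine ⟨g, Subgroup.ext fun τ => ?_⟩
  simp only [Subgroup.mem_map, MulEquiv.coe_toMonoidHom, MulAut.conj_apply]
  have key : ∀ p t, (∀ i, cubeVertex (p i) = cubeVertex i + t) → g * p * g⁻¹ = φ t := by
    intro p t hp
    rw [mul_inv_eq_iff_eq_mul]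
    ext1 i
    simp only [Equiv.Perm.mul_apply, hg, hp, hφ]
  constructor
  · intro hτ
    obtain ⟨t, ht⟩ : ∃ t, φ t = τ :=
      ⟨e.symm (Additive.ofMul ⟨τ, hτ⟩), by simp [φ]⟩
    let p : Equiv.Perm (Fin 8) := (cubeEquiv.trans (Equiv.addRight t)).trans cubeEquiv.symm
    have hp : ∀ i, cubeVertex (p i) = cubeVertex i + t := fun i =>
      cubeEquiv.apply_symm_apply (cubeVertex i + t)
    exact ⟨p, ⟨t, hp⟩, (key p t hp).trans ht⟩
  · rintro ⟨p, ⟨t, hp⟩, rfl⟩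
    rw [key p t hp]
    exact Subtype.property _

theorem aPerm_apply (t : Fin 3 → ZMod 2) :
    ∃ k, ∀ i, cubeVertex (aPerm k i) = cubeVertex i + t := by
  revert t; decide +kernel

theorem aPerm_mem_cubeTranslations (k : Fin 8) :
    ∃ t : Fin 3 → ZMod 2, ∀ i, cubeVertex (aPerm k i) = cubeVertex i + t := by
  revert k; decide +kernel

theorem coe_cubeTranslations_eq_range_aPerm :
    (cubeTranslations : Set (Equiv.Perm (Fin 8))) = Set.range aPerm := by
  ext p
  constructor
  · rintro ⟨t, ht⟩
    obtain ⟨k, hk⟩ := aPerm_apply t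
    exact ⟨k, Equiv.ext fun i => cubeVertex_injective ((hk i).trans (ht i).symm)⟩
  · rintro ⟨k, rfl⟩
    exact aPerm_mem_cubeTranslations k

theorem cubeVertex_apply_of_mem {p : Equiv.Perm (Fin 8)} (hp : p ∈ cubeTranslations)
    (i : Fin 8) : cubeVertex (p i) = cubeVertex i + cubeVertex (p 0) := by
  obtain ⟨t, ht⟩ := hp
  have h0 : cubeVertex 0 = 0 := by decide
  rw [ht, ht, h0, zero_add]

/-- A translation of the cube corresponds to the image of the origin. -/
noncomputable def cubeTranslationsEquiv :
    cubeTranslations ≃* Multiplicative (Fin 3 → ZMod 2) :=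
  MulEquiv.ofBijective
    (MonoidHom.mk' (fun p : cubeTranslations =>
        Multiplicative.ofAdd (cubeVertex ((p : Equiv.Perm (Fin 8)) 0)))
      fun p q => by
        rw [Subgroup.coe_mul, Equiv.Perm.mul_apply, cubeVertex_apply_of_mem p.2,
          add_comm, ofAdd_add])
    ⟨fun p q h => Subtype.ext <| Equiv.ext fun i => cubeVertex_injective <| by
        rw [cubeVertex_apply_of_mem p.2, cubeVertex_apply_of_mem q.2]
        exact congrArg (cubeVertex i + ·) (Multiplicative.ofAdd.injective h),
      fun t => by
        obtain ⟨k, hk⟩ := aPerm_apply t.toAdd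
        have h0 : cubeVertex 0 = 0 := by decide
        refine ⟨⟨aPerm k, t.toAdd, hk⟩, ?_⟩
        change Multiplicative.ofAdd (cubeVertex (aPerm k 0)) = t
        rw [hk, h0, zero_add, ofAdd_toAdd]⟩

theorem not_normal_cubeTranslations : ¬ cubeTranslations.Normal := by
  intro h
  -- The conjugate `(0 2)(1 3)(4 5)(6 7)` moves `0` and `4` by different vectors.
  obtain ⟨t, ht⟩ := h.conj_mem (aPerm 1) (aPerm_mem_cubeTranslations 1) (Equiv.swap 1 2)
  revert t
  decide +kernel

end Cube

/-- A transitive family of commuting involutions consists of the elements of a group. -/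
theorem exists_subgroup_of_commuting_transitive {ι α : Type*} (a : α)
    (τ : ι → Equiv.Perm α) (hone : ∃ i, τ i = 1) (hsq : ∀ i, τ i * τ i = 1)
    (hcomm : ∀ i j, τ i * τ j = τ j * τ i) (htrans : ∀ x, ∃ i, τ i a = x) :
    ∃ T : Subgroup (Equiv.Perm α), (T : Set (Equiv.Perm α)) = Set.range τ :=
  ⟨{ carrier := Set.range τ
     one_mem' := hone
     mul_mem' := by
      rintro _ _ ⟨i, rfl⟩ ⟨j, rfl⟩
      -- `τ k` agrees with `τ i * τ j` at `a`; both commute with every `τ m`, so they agree on the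
      -- orbit of `a`, which is everything.
      obtain ⟨k, hk⟩ := htrans ((τ i * τ j) a)
      refine ⟨k, Equiv.ext fun x => ?_⟩
      obtain ⟨m, rfl⟩ := htrans x
      have hc : τ i * τ j * τ m = τ m * (τ i * τ j) := by
        rw [mul_assoc, hcomm j m, ← mul_assoc, hcomm i m, mul_assoc]
      rw [← Equiv.Perm.mul_apply, hcomm, Equiv.Perm.mul_apply, hk, ← Equiv.Perm.mul_apply, ← hc,
        Equiv.Perm.mul_apply]
     inv_mem' := by
      rintro _ ⟨i, rfl⟩
      exact ⟨i, (inv_eq_of_mul_eq_one_right (hsq i)).symm⟩ }, rfl⟩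

namespace IsGR

/-- The absolute values of a `GR(8, 8)` family form a coset of a conjugate of the group of
translations of the cube. -/
theorem exists_range_entrywiseAbs_eq {L : Fin 8 → Matrix (Fin 8) (Fin 8) ℝ} (hL : IsGR 8 8 L) :
    ∃ B : Subgroup (Equiv.Perm (Fin 8)), IsConjSubgroup cubeTranslations B ∧
      ∃ π : Equiv.Perm (Fin 8),
        Set.range (fun I => entrywiseAbs (L I))
          = permToMatrix '' (π • (B : Set (Equiv.Perm (Fin 8)))) := by
  choose σ hσ using fun I => (hL.signedPerm I).exists_perm
  have hanti : ∀ I J, I ≠ J → (L I).transpose * L J + (L J).transpose * L I = 0 := by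
    intro I J hIJ
    simpa [hIJ] using hL.transpose_mul I J
  have hmul : ∀ I J, σ I * (σ J)⁻¹ * σ I = σ J := by
    intro I J
    rcases eq_or_ne I J with rfl | hIJ
    · simp
    · exact mul_inv_mul_of_anticommute (hσ I) (hσ J) (hanti I J hIJ)
  -- Normalised so that `τ 0 = 1`; `σ 0` will be the coset representative.
  let τ : Fin 8 → Equiv.Perm (Fin 8) := fun I => (σ 0)⁻¹ * σ I
  have hsq : ∀ I, τ I * τ I = 1 := by
    intro I
    simp only [τ]
    rw [mul_assoc, ← mul_assoc (σ I), hmul, inv_mul_cancel]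
  have hcomm : ∀ I J, τ I * τ J = τ J * τ I := by
    intro I J
    have hinv : ∀ K, (τ K)⁻¹ = τ K := fun K => inv_eq_of_mul_eq_one_right (hsq K)
    have h : τ I * (τ J)⁻¹ * τ I = τ J := by
      simp only [τ, mul_inv_rev, inv_inv]
      nth_rewrite 2 [← hmul I J]
      group
    rw [hinv] at h
    rw [← mul_inv_eq_iff_eq_mul, hinv, h]
  have hinj : ∀ x, Function.Injective fun I => τ I x := by
    intro x I J h
    by_contra hIJ
    exact apply_ne_of_anticommute (hσ I) (hσ J) (hanti I J hIJ) x ((σ 0)⁻¹.injective h)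
  obtain ⟨T, hT⟩ := exists_subgroup_of_commuting_transitive 0 τ ⟨0, inv_mul_cancel _⟩ hsq hcomm
    (Finite.surjective_of_injective (hinj 0))
  have hmem : ∀ t, t ∈ T ↔ t ∈ Set.range τ := fun t => by rw [← hT, SetLike.mem_coe]
  refine ⟨T, isConjSubgroup_cubeTranslations_of_regular T ?_ ⟨?_, ?_⟩, σ 0, ?_⟩
  · intro t ht
    obtain ⟨I, rfl⟩ := (hmem t).mp ht
    exact hsq I
  · rintro ⟨s, hs⟩ ⟨t, ht⟩ h
    obtain ⟨I, rfl⟩ := (hmem s).mp hs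
    obtain ⟨J, rfl⟩ := (hmem t).mp ht
    obtain rfl := hinj 0 h
    rfl
  · intro x
    obtain ⟨I, hI⟩ := Finite.surjective_of_injective (hinj 0) x
    exact ⟨⟨τ I, (hmem _).mpr ⟨I, rfl⟩⟩, hI⟩
  · have hcoset : σ 0 • (T : Set (Equiv.Perm (Fin 8))) = Set.range σ := by
      rw [hT, Set.smul_set_range]
      simp [τ]
    rw [hcoset, ← Set.range_comp]
    exact congrArg Set.range
      (funext fun I => entrywiseAbs_eq_permToMatrix (hL.signedPerm I) (hσ I))

end IsGR

theorem mainTheorem2 :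
    (∀ L : Fin 8 → Matrix (Fin 8) (Fin 8) ℝ, IsGR 8 8 L →
      ∃ B : Subgroup (Equiv.Perm (Fin 8)), IsConjSubgroup cubeTranslations B ∧
        ∃ π : Equiv.Perm (Fin 8),
          Set.range (fun I => entrywiseAbs (L I))
            = permToMatrix '' (π • (B : Set (Equiv.Perm (Fin 8))))) ∧
    (cubeTranslations : Set (Equiv.Perm (Fin 8))) = Set.range aPerm ∧
    Nonempty (cubeTranslations ≃* Multiplicative (Fin 3 → ZMod 2)) ∧
    ¬ cubeTranslations.Normal :=
  ⟨fun _ hL => hL.exists_range_entrywiseAbs_eq, coe_cubeTranslations_eq_range_aPerm,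
    ⟨cubeTranslationsEquiv⟩, not_normal_cubeTranslations⟩
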